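/- Let $0<p\le 1$ and $c\ge 0$, and write $\bar p=1-p$. Let $\mathcal M$ be the Markov decision process with state space $S=\{(x,y): x\in\{0,1,2,\dots\},\ y\in\{1,2,\dots\}\}$, action set $A=\{0,1\}$, cost $C((x,y);a)=y+ca$, and the following transitions from $(x,y)$: under $a=1$ to $(0,x+1)$ with probability $p$ and to $(x+1,x+1)$ with probability $\bar p$; under $a=0$ to $(0,y+1)$ with probability $p$ and to $(x+1,y+1)$ with probability $\bar p$. A policy may be history dependent and randomized. For a policy $\pi$, an initial state $s$ and $\alpha\in(0,1)$, put $$g_\pi(s)=\limsup_{T\to\infty}\frac1T\,\mathbb E_\pi\Big[\sum_{t=0}^{T-1}C(s(t);a(t))\,\Big|\,s(0)=s\Big],\qquad V_\alpha(s)=\inf_\pi \mathbb E_\pi\Big[\sum_{t=0}^\infty \alpha^t C(s(t);a(t))\,\Big|\,s(0)=s\Big].$$ A policy $\pi^*$ is average-cost optimal if $g_{\pi^*}(s)=\inf_\pi g_\pi(s)$ for every $s\in S$, the infimum being over all policies. Let $M(s)$ be the expected cost of first passage from $s$ to $(0,1)$ under the policy that takes $a=1$ in every slot, i.e. the expectation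 of $\sum_{t<\tau}C(s(t);a(t))$ with $\tau=\inf\{t\ge 1: s(t)=(0,1)\}$. Then $M(s)<\infty$ for every $s$, and $\mathcal M$ satisfies Sennott's conditions with reference state $(0,1)$, $N=0$ and this $M$: 1. $V_\alpha(s)<\infty$ for every $s\in S$ and $\alpha\in(0,1)$; 2. $0\le V_\alpha(s)-V_\alpha(0,1)\le M(s)$ for every $s\in S$ and $\alpha\in(0,1)$, where $M(s)\ge 0$; 3. $\sum_{s'}\mathbb P_{s,s'}(a)M(s')<\infty$ for every $s\in S$ and $a\in A$. Moreover there are a stationary deterministic policy $\pi^*:S\to A$, a constant $g\in\mathbb R$ and a function $f:S\to\mathbb R$ such that $\pi^*$ is average-cost optimal, $g_{\pi^*}(s)=g$ and $g=\lim_{\alpha\to1^-}(1-\alpha)V_\alpha(s)$ for every $s\in S$, $0\le f(s)\le M(s)$ for every $s\in S$, $f(0,1)=0$, and for all $(x,y)\in S$ $$g+f(x,y)=\min\{\,y+pf(0,y+1)+\bar p f(x+1,y+1),\ \ y+c+pf(0,x+1)+\bar p f(x+1,x+1)\,\}.$$ -/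

import Mathlib

open Filter Topology
open scoped NNReal ENNReal

noncomputable section

/-- A Markov decision process with state space `S`, action space `A` and nonnegative costs. -/
structure MDP (S A : Type) where
  /-- the law of the next state, given the current state and action -/
  trans : S → A → PMF S
  /-- the cost of a slot, given the current state and action -/
  cost : S → A → ℝ≥0

namespace MDP

variable {S A : Type}

/-- The information available at the start of slot `t`: the pairs
`[(s (t-1), a (t-1)), …, (s 0, a 0)]`, most recent first, together with the current state `s t`. -/
abbrev Hist (S A : Type) : Type := List (S × A) × S

/-- A general (history dependent and randomized) policy: a law on actions for each history. -/
abbrev Policy (S A : Type) : Type := Hist S A → PMF A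

/-- The stationary deterministic policy that takes the action `d s` whenever the state is `s`. -/
def stationary (d : S → A) : Policy S A := fun h => PMF.pure (d h.2)

/-- One slot: draw an action from the policy, then the next state from the transition law. -/
def step (M : MDP S A) (π : Policy S A) (h : Hist S A) : PMF (Hist S A) :=
  (π h).bind fun a => (M.trans h.2 a).map fun s' => ((h.2, a) :: h.1, s')

/-- The law of the history after `t` slots under the policy `π`, starting from the history `h`. -/
def histLaw (M : MDP S A) (π : Policy S A) : ℕ → Hist S A → PMF (Hist S A)
  | 0, h => PMF.pure h
  | t + 1, h => (M.histLaw π t h).bind (M.step π)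

/-- The expected cost of the current slot, given the history. -/
def condCost (M : MDP S A) (π : Policy S A) (h : Hist S A) : ℝ≥0∞ :=
  ∑' a, π h a * (M.cost h.2 a : ℝ≥0∞)

/-- `E_π[C(s t; a t)]` when the process starts in state `s` at time `0`. -/
def stageCost (M : MDP S A) (π : Policy S A) (s : S) (t : ℕ) : ℝ≥0∞ :=
  ∑' h, M.histLaw π t ([], s) h * M.condCost π h

/-- The expected average cost `limsup_T (1/T) E_π[∑_{t<T} C(s t; a t)]` from state `s`. -/
def avgCost (M : MDP S A) (π : Policy S A) (s : S) : ℝ≥0∞ :=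
  limsup (fun T : ℕ => (∑ t ∈ Finset.range T, M.stageCost π s t) / (T : ℝ≥0∞)) atTop

/-- A policy is average-cost optimal if it attains, from every initial state, the infimum of the
expected average cost over all policies. -/
def IsAvgOptimal (M : MDP S A) (π : Policy S A) : Prop :=
  ∀ s, M.avgCost π s = ⨅ π' : Policy S A, M.avgCost π' s

/-- The expected total `α`-discounted cost `E_π[∑_t α^t C(s t; a t)]` from state `s`. -/
def discCost (M : MDP S A) (α : ℝ) (π : Policy S A) (s : S) : ℝ≥0∞ :=
  ∑' t : ℕ, ENNReal.ofReal α ^ t * M.stageCost π s t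

/-- The `α`-discounted value function `V_α(s)`: the infimum of the discounted cost over all
policies. -/
def discValue (M : MDP S A) (α : ℝ) (s : S) : ℝ≥0∞ :=
  ⨅ π : Policy S A, M.discCost α π s

open Classical in
/-- The expected cost of first passage from `s` to `z` under `π`, that is
`E_π[∑_{t<τ} C(s t; a t)]` for `τ = inf {t ≥ 1 : s t = z}`. The entries `s t, …, s 1` of the
history are the first `t` elements of the list of visited states, and `τ > t` says that `z` is
not among them. -/
def firstPassageCost (M : MDP S A) (π : Policy S A) (z s : S) : ℝ≥0∞ :=
  ∑' t : ℕ, ∑' h : Hist S A, M.histLaw π t ([], s) h *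
    (if z ∈ (h.2 :: h.1.map Prod.fst).take t then 0 else M.condCost π h)

/-- Sennott's conditions, with reference state `z`, lower bound `-N` and upper bound `B`. -/
structure SennottConditions (M : MDP S A) (z : S) (N : ℝ) (B : S → ℝ) : Prop where
  bound_nonneg : ∀ s, 0 ≤ B s
  value_finite : ∀ α : ℝ, 0 < α → α < 1 → ∀ s, M.discValue α s < ⊤
  lower : ∀ α : ℝ, 0 < α → α < 1 → ∀ s,
    -N ≤ (M.discValue α s).toReal - (M.discValue α z).toReal
  upper : ∀ α : ℝ, 0 < α → α < 1 → ∀ s,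
    (M.discValue α s).toReal - (M.discValue α z).toReal ≤ B s
  next_finite : ∀ s a, ∑' s', M.trans s a s' * ENNReal.ofReal (B s') < ⊤

end MDP

/-- States `(x, y)`: the age `x ≥ 0` in the memory and the age `y ≥ 1` at the client. -/
abbrev AgeState : Type := ℕ × ℕ+

/-- Whether a fresh update is written in a slot: `true` with probability `p`. -/
def updateCoin (p : ℝ≥0) (hp : p ≤ 1) : PMF Bool :=
  PMF.ofFintype (fun u => if u then (p : ℝ≥0∞) else 1 - (p : ℝ≥0∞)) (by
    have h : (p : ℝ≥0∞) ≤ 1 := by exact_mod_cast hp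
    simp [add_tsub_cancel_of_le h])

/-- The memory sampling MDP with update probability `p` and sampling cost `c`. The action `true`
is to read, `false` is to idle. -/
def memoryMDP (p c : ℝ≥0) (hp : p ≤ 1) : MDP AgeState Bool where
  trans s a := (updateCoin p hp).map fun u =>
    (if u then 0 else s.1 + 1, if a then s.1.succPNat else s.2 + 1)
  cost s a := (s.2 : ℕ) + c * (if a then 1 else 0)

/-- The reference state `(0, 1)`. -/
def refState : AgeState := (0, 1)

/-- The expected cost of first passage to the reference state under the policy that reads in
every slot. -/
def alwaysReadPassageCost (p c : ℝ≥0) (hp : p ≤ 1) (s : AgeState) : ℝ≥0∞ :=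
  (memoryMDP p c hp).firstPassageCost (MDP.stationary fun _ => true) refState s

end

/-! This is the vanishing discount method. Value iteration from zero increases to V_α: each iterate
bounds every policy from below, and a policy greedy for the limit attains it
(`MDP.discValue_eq_iSup`). Hence V_α solves the discounted optimality equation and inherits
monotonicity from the dynamics. As (0,1) is the least state, the relative value V_α(s) - V_α(0,1) is
nonnegative. Always reading until (0,1) is hit bounds it above by M(s), which an explicit Lyapunov
function shows to be finite.

The relative values thus lie in compact intervals independent of α, so along any ultrafilter tending
to 1 from the left they converge at every state at once, and the optimality equation passes to the
limit (`exists_vanishing_discount_limit`). A policy greedy for the limit has average cost at most g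
(`exists_avgCost_stationary_le`), while an Abelian inequality gives every policy at least g
(`MDP.le_avgCost_of_tendsto`). So g does not depend on the ultrafilter, which yields the full limit.
-/

/-- The expectation of a nonnegative function under a discrete law. -/
noncomputable def PMF.expect {α : Type} (μ : PMF α) (F : α → ℝ≥0∞) : ℝ≥0∞ := ∑' a, μ a * F a

namespace PMF

variable {α β : Type}

theorem expect_pure (a : α) (F : α → ℝ≥0∞) : (PMF.pure a).expect F = F a := by
  rw [expect, tsum_eq_single a]
  · simp
  · intro b hb
    simp [hb]

theorem expect_bind (μ : PMF α) (κ : α → PMF β) (F : β → ℝ≥0∞) :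
    (μ.bind κ).expect F = μ.expect fun a => (κ a).expect F := by
  simp only [expect, PMF.bind_apply, ← ENNReal.tsum_mul_right, ← ENNReal.tsum_mul_left]
  rw [ENNReal.tsum_comm]
  simp only [mul_assoc]

theorem expect_map (μ : PMF α) (k : α → β) (F : β → ℝ≥0∞) :
    (μ.map k).expect F = μ.expect fun a => F (k a) := by
  rw [← PMF.bind_pure_comp, expect_bind]
  simp only [Function.comp, expect_pure]

theorem expect_mono (μ : PMF α) {F G : α → ℝ≥0∞} (h : ∀ a, F a ≤ G a) :
    μ.expect F ≤ μ.expect G :=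
  ENNReal.tsum_le_tsum fun a => by gcongr; exact h a

theorem expect_const (μ : PMF α) (k : ℝ≥0∞) : (μ.expect fun _ => k) = k := by
  rw [expect, ENNReal.tsum_mul_right, PMF.tsum_coe, one_mul]

theorem expect_add (μ : PMF α) (F G : α → ℝ≥0∞) :
    (μ.expect fun a => F a + G a) = μ.expect F + μ.expect G := by
  simp only [expect, mul_add, ENNReal.tsum_add]

theorem expect_const_mul (μ : PMF α) (k : ℝ≥0∞) (F : α → ℝ≥0∞) :
    (μ.expect fun a => k * F a) = k * μ.expect F := by
  simp only [expect, ← ENNReal.tsum_mul_left, mul_left_comm]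

theorem expect_tsum (μ : PMF α) (F : ℕ → α → ℝ≥0∞) :
    (μ.expect fun a => ∑' n, F n a) = ∑' n, μ.expect (F n) := by
  simp only [expect, ← ENNReal.tsum_mul_left]
  rw [ENNReal.tsum_comm]

theorem le_expect_of_forall_le (μ : PMF α) {k : ℝ≥0∞} {F : α → ℝ≥0∞} (h : ∀ a, k ≤ F a) :
    k ≤ μ.expect F :=
  (expect_const μ k).ge.trans (expect_mono μ h)

end PMF

/-! ### Verification inequalities for general policies -/

namespace MDP

variable {S A : Type} (M : MDP S A)

theorem expect_step (π : Policy S A) (h : Hist S A) (F : Hist S A → ℝ≥0∞) :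
    (M.step π h).expect F =
      (π h).expect fun a => (M.trans h.2 a).expect fun s' => F ((h.2, a) :: h.1, s') := by
  simp only [step, PMF.expect_bind, PMF.expect_map]

theorem expect_histLaw_succ (π : Policy S A) (t : ℕ) (h : Hist S A) (F : Hist S A → ℝ≥0∞) :
    (M.histLaw π (t + 1) h).expect F =
      (M.histLaw π t h).expect fun h' => (M.step π h').expect F := by
  rw [histLaw, PMF.expect_bind]

/-- The cost of taking action `a` in state `s` plus the discounted expectation of a terminal
cost `w`. -/
noncomputable def lookahead (α : ℝ≥0∞) (w : S → ℝ≥0∞) (s : S) (a : A) : ℝ≥0∞ :=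
  M.cost s a + α * (M.trans s a).expect w

theorem expect_lookahead (π : Policy S A) (α : ℝ≥0∞) (w : S → ℝ≥0∞) (h : Hist S A) :
    (π h).expect (M.lookahead α w h.2) =
      M.condCost π h + α * (M.step π h).expect fun h' => w h'.2 := by
  change (π h).expect (fun a => M.cost h.2 a + α * (M.trans h.2 a).expect w) = _
  simp only [PMF.expect_add, PMF.expect_const_mul, expect_step]
  rfl

theorem expect_histLaw_lookahead (π : Policy S A) (α : ℝ≥0∞) (w : S → ℝ≥0∞) (s : S) (t : ℕ) :
    ((M.histLaw π t ([], s)).expect fun h => (π h).expect (M.lookahead α w h.2)) =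
      M.stageCost π s t + α * (M.histLaw π (t + 1) ([], s)).expect fun h => w h.2 := by
  simp only [expect_lookahead, PMF.expect_add, PMF.expect_const_mul, expect_histLaw_succ]
  rfl

/-- Verification: a stationary policy whose one-step costs are dominated by `γ + w`. -/
theorem sum_stageCost_stationary_le {α γ : ℝ≥0∞} (hα : α ≤ 1) {w : S → ℝ≥0∞} {d : S → A}
    (hd : ∀ s, M.lookahead α w s (d s) ≤ γ + w s) (s : S) (T : ℕ) :
    ∑ t ∈ Finset.range T, α ^ t * M.stageCost (stationary d) s t ≤ T * γ + w s := by
  -- Keeping the expected terminal cost in the bound makes the induction telescope.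
  suffices H : ∑ t ∈ Finset.range T, α ^ t * M.stageCost (stationary d) s t +
      α ^ T * (M.histLaw (stationary d) T ([], s)).expect (fun h => w h.2) ≤ T * γ + w s from
    le_self_add.trans H
  induction T with
  | zero => simp [histLaw, PMF.expect_pure]
  | succ T ih =>
    have h1 := M.expect_histLaw_lookahead (stationary d) α w s T
    have h2 : ((M.histLaw (stationary d) T ([], s)).expect fun h =>
        (stationary d h).expect (M.lookahead α w h.2)) ≤
        γ + (M.histLaw (stationary d) T ([], s)).expect fun h => w h.2 := by
      rw [← PMF.expect_const (M.histLaw (stationary d) T ([], s)) γ, ← PMF.expect_add]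
      refine PMF.expect_mono _ fun h => ?_
      rw [stationary, PMF.expect_pure]
      exact hd h.2
    rw [h1] at h2
    calc _ = ∑ t ∈ Finset.range T, α ^ t * M.stageCost (stationary d) s t +
          α ^ T * (M.stageCost (stationary d) s T +
          α * (M.histLaw (stationary d) (T + 1) ([], s)).expect fun h => w h.2) := by
          rw [Finset.sum_range_succ]; ring
      _ ≤ ∑ t ∈ Finset.range T, α ^ t * M.stageCost (stationary d) s t +
          α ^ T * (γ + (M.histLaw (stationary d) T ([], s)).expect fun h => w h.2) := by gcongr
      _ = α ^ T * γ + (∑ t ∈ Finset.range T, α ^ t * M.stageCost (stationary d) s t +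
          α ^ T * (M.histLaw (stationary d) T ([], s)).expect fun h => w h.2) := by ring
      _ ≤ 1 * γ + (T * γ + w s) := by gcongr; exact pow_le_one' hα T
      _ = _ := by push_cast; ring

/-- Any sequence dominated by its own one-step lookahead bounds the discounted cost from below. -/
theorem le_discCost {α : ℝ} {v : ℕ → S → ℝ≥0∞} (h0 : ∀ s, v 0 s = 0)
    (hv : ∀ n s a, v (n + 1) s ≤ M.lookahead (ENNReal.ofReal α) (v n) s a)
    (π : Policy S A) (s : S) (n : ℕ) : v n s ≤ M.discCost α π s := by
  -- The spare index `m` lets each induction step trade one lookahead for one more slot of the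
  -- process.
  suffices H : ∀ n m, v (n + m) s ≤
      ∑ t ∈ Finset.range n, ENNReal.ofReal α ^ t * M.stageCost π s t +
      ENNReal.ofReal α ^ n * (M.histLaw π n ([], s)).expect fun h => v m h.2 by
    refine (H n 0).trans ?_
    simp only [h0, PMF.expect_const, mul_zero, add_zero]
    exact ENNReal.sum_le_tsum _
  intro n
  induction n with
  | zero => intro m; simp [histLaw, PMF.expect_pure]
  | succ n ih =>
    intro m
    rw [show n + 1 + m = n + (m + 1) by ring, Finset.sum_range_succ, pow_succ, mul_assoc,
      add_assoc, ← mul_add, ← expect_histLaw_lookahead]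
    refine (ih (m + 1)).trans ?_
    gcongr
    exact PMF.expect_mono _ fun h => PMF.le_expect_of_forall_le _ fun a => hv m h.2 a

theorem discCost_stationary_le {α : ℝ} (hα : α ≤ 1) {w : S → ℝ≥0∞} {d : S → A}
    (hd : ∀ s, M.lookahead (ENNReal.ofReal α) w s (d s) ≤ w s) (s : S) :
    M.discCost α (stationary d) s ≤ w s := by
  refine ENNReal.tsum_le_of_sum_range_le fun T => ?_
  simpa using M.sum_stageCost_stationary_le (γ := 0) (ENNReal.ofReal_le_one.2 hα)
    (fun s => (hd s).trans (by simp)) s T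

/-! ### First passage costs -/

open Classical in
/-- The expectation of `r` after one slot under the stationary policy `d`, killed at `z`. -/
noncomputable def killed (d : S → A) (z : S) (r : S → ℝ≥0∞) (s : S) : ℝ≥0∞ :=
  (M.trans s (d s)).expect fun s' => if s' = z then 0 else r s'

-- `take t` omits the initial state, so `z` is tested only from time 1 on. The induction peels off
-- the last slot, turning `r` into `killed r`; hence `r` stays general.
open Classical in
theorem expect_histLaw_killed (d : S → A) (z s : S) (t : ℕ) (r : S → ℝ≥0∞) :
    ((M.histLaw (stationary d) t ([], s)).expect fun h =>
      if z ∈ (h.2 :: h.1.map Prod.fst).take t then 0 else r h.2) = (M.killed d z)^[t] r s := by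
  induction t generalizing r with
  | zero => simp [histLaw, PMF.expect_pure]
  | succ t ih =>
    rw [Function.iterate_succ_apply, ← ih, expect_histLaw_succ]
    congr 1
    funext h
    rw [expect_step, stationary, PMF.expect_pure]
    simp only [List.take_succ_cons, List.map_cons, List.mem_cons]
    split_ifs with hz
    · simp [hz, PMF.expect_const]
    · simp [hz, killed, eq_comm]

theorem firstPassageCost_stationary (d : S → A) (z s : S) :
    M.firstPassageCost (stationary d) z s =
      ∑' t, (M.killed d z)^[t] (fun s => (M.cost s (d s) : ℝ≥0∞)) s := by
  simp only [← expect_histLaw_killed]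
  refine tsum_congr fun t => tsum_congr fun h => ?_
  have : M.condCost (stationary d) h = M.cost h.2 (d h.2) :=
    PMF.expect_pure (d h.2) fun a => (M.cost h.2 a : ℝ≥0∞)
  rw [this]

open Classical in
theorem firstPassageCost_stationary_eq (d : S → A) (z s : S) :
    M.firstPassageCost (stationary d) z s = M.cost s (d s) +
      (M.trans s (d s)).expect fun s' =>
        if s' = z then 0 else M.firstPassageCost (stationary d) z s' := by
  rw [firstPassageCost_stationary, tsum_eq_zero_add' ENNReal.summable]
  congr 1
  simp only [Function.iterate_succ_apply', firstPassageCost_stationary]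
  simp only [killed, ← PMF.expect_tsum]
  congr 1
  funext s'
  split_ifs <;> simp

-- Truncated sums are bounded by induction on the horizon, conditioning on the first slot.
open Classical in
theorem firstPassageCost_stationary_le (d : S → A) (z : S) {w : S → ℝ≥0∞}
    (hw : ∀ s, (M.cost s (d s) : ℝ≥0∞) +
      ((M.trans s (d s)).expect fun s' => if s' = z then 0 else w s') ≤ w s) (s : S) :
    M.firstPassageCost (stationary d) z s ≤ w s := by
  rw [firstPassageCost_stationary]
  refine ENNReal.tsum_le_of_sum_range_le fun T => ?_
  induction T generalizing s with
  | zero => simp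
  | succ T ih =>
    refine le_trans ?_ (hw s)
    rw [Finset.sum_range_succ', add_comm]
    refine add_le_add le_rfl ?_
    simp only [Function.iterate_succ_apply']
    have : ∀ n, ∀ F : ℕ → S → ℝ≥0∞, ∑ t ∈ Finset.range n, M.killed d z (F t) s =
        (M.trans s (d s)).expect fun s' =>
          if s' = z then 0 else ∑ t ∈ Finset.range n, F t s' := by
      intro n F
      induction n with
      | zero => simp [PMF.expect_const]
      | succ n ihn =>
        rw [Finset.sum_range_succ, ihn, killed, ← PMF.expect_add]
        congr 1
        funext s'
        split_ifs <;> simp [Finset.sum_range_succ]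
    rw [this]
    refine PMF.expect_mono _ fun s' => ?_
    split_ifs
    · exact le_rfl
    · exact ih s'

end MDP

/-! ### From average cost to discounted cost -/

/-- An Abelian bound: linear growth of the partial sums controls the discounted sums. -/
theorem sum_pow_mul_le_of_sum_le {c : ℕ → ℝ≥0∞} {α : ℝ≥0∞} (hα : α ≤ 1) (L K : ℝ≥0)
    (h : ∀ n : ℕ, ∑ t ∈ Finset.range n, c t ≤ L * n + K) (n : ℕ) :
    ∑ t ∈ Finset.range n, α ^ t * c t ≤ L * ∑ t ∈ Finset.range n, α ^ t + K := by
  -- `D` is the slack in the undiscounted bound. Carrying it with weight `α ^ n` amounts to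
  -- summation by parts: `c n + D' = D + L` and `α ^ (n + 1) ≤ α ^ n`.
  suffices H : ∃ D, ∑ t ∈ Finset.range n, c t + D = L * n + K ∧
      ∑ t ∈ Finset.range n, α ^ t * c t + α ^ n * D ≤ L * ∑ t ∈ Finset.range n, α ^ t + K by
    obtain ⟨D, -, hD⟩ := H
    exact le_self_add.trans hD
  induction n with
  | zero => exact ⟨K, by simp⟩
  | succ n ih =>
    obtain ⟨D, hD, hle⟩ := ih
    obtain ⟨D', hD'⟩ := exists_add_of_le (h (n + 1))
    refine ⟨D', hD'.symm, ?_⟩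
    have hfin : ∑ t ∈ Finset.range n, c t ≠ ⊤ :=
      ((h n).trans_lt (by finiteness)).ne
    have hc : c n + D' = D + L := by
      refine (ENNReal.add_right_inj hfin).1 ?_
      rw [← add_assoc, ← add_assoc, hD, ← Finset.sum_range_succ, ← hD']
      push_cast
      ring
    rw [Finset.sum_range_succ, Finset.sum_range_succ]
    calc _ ≤ ∑ t ∈ Finset.range n, α ^ t * c t + α ^ n * c n + α ^ n * D' := by
          refine add_le_add le_rfl ?_
          exact mul_le_mul_left (pow_le_pow_right_of_le_one' hα n.le_succ) D'
      _ = (∑ t ∈ Finset.range n, α ^ t * c t + α ^ n * D) + α ^ n * L := by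
          rw [add_assoc, ← mul_add, hc]; ring
      _ ≤ (L * ∑ t ∈ Finset.range n, α ^ t + K) + α ^ n * L := by gcongr
      _ = _ := by ring

/-- `K` is chosen before `α`, so its term vanishes as `α → 1`. It absorbs the finitely many horizons
at which the average may still exceed `L`. -/
theorem MDP.exists_discCost_le_of_avgCost_lt {S A : Type} (M : MDP S A) (π : MDP.Policy S A)
    (s : S) {L : ℝ≥0} (hL : M.avgCost π s < L) :
    ∃ K : ℝ≥0, ∀ α : ℝ, 0 < α → α < 1 →
      ENNReal.ofReal (1 - α) * M.discCost α π s ≤ L + ENNReal.ofReal (1 - α) * K := by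
  have hev := eventually_lt_of_limsup_lt hL
  obtain ⟨T₀, hT₀⟩ := (hev.and (eventually_ge_atTop 1)).exists_forall_of_atTop
  have hlin : ∀ n ≥ T₀, ∑ t ∈ Finset.range n, M.stageCost π s t ≤ L * n := by
    intro n hn
    obtain ⟨h1, h2⟩ := hT₀ n hn
    refine (ENNReal.div_le_iff ?_ (ENNReal.natCast_ne_top n)).1 h1.le
    exact_mod_cast (by lia : n ≠ 0)
  refine ⟨L * T₀, fun α h0 h1 => ?_⟩
  have hbound : ∀ n : ℕ, ∑ t ∈ Finset.range n, M.stageCost π s t ≤ L * n + (L * T₀ : ℝ≥0) := by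
    intro n
    push_cast
    rcases le_total T₀ n with hn | hn
    · exact (hlin n hn).trans le_self_add
    · exact (Finset.sum_le_sum_of_subset (Finset.range_mono hn)).trans
        ((hlin T₀ le_rfl).trans le_add_self)
  have hα : ENNReal.ofReal α ≤ 1 := ENNReal.ofReal_le_one.2 h1.le
  have hdisc : M.discCost α π s ≤ L * (1 - ENNReal.ofReal α)⁻¹ + (L * T₀ : ℝ≥0) := by
    refine ENNReal.tsum_le_of_sum_range_le fun n => ?_
    refine (sum_pow_mul_le_of_sum_le hα L _ hbound n).trans ?_
    gcongr
    rw [← ENNReal.tsum_geometric]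
    exact ENNReal.sum_le_tsum _
  have hsub : 1 - ENNReal.ofReal α = ENNReal.ofReal (1 - α) := by
    rw [ENNReal.ofReal_sub _ h0.le, ENNReal.ofReal_one]
  rw [hsub] at hdisc
  calc _ ≤ ENNReal.ofReal (1 - α) * (L * (ENNReal.ofReal (1 - α))⁻¹ + (L * T₀ : ℝ≥0)) := by gcongr
    _ = L * (ENNReal.ofReal (1 - α) * (ENNReal.ofReal (1 - α))⁻¹) +
        ENNReal.ofReal (1 - α) * (L * T₀ : ℝ≥0) := by ring
    _ = _ := by
      rw [ENNReal.mul_inv_cancel (by simpa using h1) ENNReal.ofReal_ne_top, mul_one]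

/-! ### Value iteration and the discounted optimality equation -/

theorem PMF.expect_iSup {α : Type} (μ : PMF α) {F : ℕ → α → ℝ≥0∞} (hF : Monotone F) :
    (μ.expect fun a => ⨆ n, F n a) = ⨆ n, μ.expect (F n) := by
  simp only [PMF.expect, ENNReal.tsum_eq_iSup_sum, ENNReal.mul_iSup]
  rw [iSup_comm]
  refine iSup_congr fun t => ENNReal.finsetSum_iSup_of_monotone fun a m n hmn => ?_
  gcongr
  exact hF hmn a

namespace MDP

variable {S A : Type}

theorem lookahead_mono (M : MDP S A) (α : ℝ≥0∞) {w w' : S → ℝ≥0∞} (h : w ≤ w') (s : S) (a : A) :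
    M.lookahead α w s a ≤ M.lookahead α w' s a := by
  unfold lookahead
  gcongr
  exact PMF.expect_mono _ h

variable (M : MDP S Bool)

/-- Value iteration from the zero function, for a process with two actions. -/
noncomputable def valueIter (α : ℝ≥0∞) : ℕ → S → ℝ≥0∞
  | 0, _ => 0
  | n + 1, s => min (M.lookahead α (valueIter α n) s false) (M.lookahead α (valueIter α n) s true)

theorem valueIter_succ_le (α : ℝ≥0∞) (n : ℕ) (s : S) (a : Bool) :
    M.valueIter α (n + 1) s ≤ M.lookahead α (M.valueIter α n) s a := by
  cases a
  · exact min_le_left _ _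
  · exact min_le_right _ _

theorem monotone_valueIter (α : ℝ≥0∞) : Monotone (M.valueIter α) := by
  refine monotone_nat_of_le_succ fun n => ?_
  induction n with
  | zero => exact fun s => zero_le
  | succ n ih =>
    exact fun s => min_le_min (M.lookahead_mono α ih s false) (M.lookahead_mono α ih s true)

/-- Monotone convergence moves the supremum through the expectation, and suprema of increasing
sequences commute with a binary minimum. -/
theorem iSup_valueIter_eq (α : ℝ≥0∞) (s : S) :
    ⨆ n, M.valueIter α n s =
      min (M.lookahead α (fun s => ⨆ n, M.valueIter α n s) s false)
        (M.lookahead α (fun s => ⨆ n, M.valueIter α n s) s true) := by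
  have hmono := M.monotone_valueIter α
  have hl : ∀ a, M.lookahead α (fun s => ⨆ n, M.valueIter α n s) s a =
      ⨆ n, M.lookahead α (M.valueIter α n) s a := fun a => by
    simp only [lookahead, PMF.expect_iSup _ hmono, ENNReal.mul_iSup, ENNReal.add_iSup]
  rw [hl, hl, ← iSup_inf_of_monotone (fun m n h => M.lookahead_mono α (hmono h) s false)
    (fun m n h => M.lookahead_mono α (hmono h) s true)]
  refine le_antisymm (iSup_le fun n => ?_) (iSup_le fun n => ?_)
  · exact (hmono n.le_succ s).trans (le_iSup (fun n => M.lookahead α (M.valueIter α n) s false ⊓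
      M.lookahead α (M.valueIter α n) s true) n)
  · exact le_iSup (fun n => M.valueIter α n s) (n + 1)

/-- A choice between two actions minimizing a given cost. -/
theorem exists_greedy (q : S → Bool → ℝ≥0∞) :
    ∃ d : S → Bool, ∀ s, q s (d s) = min (q s false) (q s true) := by
  have : ∀ s, ∃ a, q s a = min (q s false) (q s true) := fun s => by
    rcases min_choice (q s false) (q s true) with h | h
    · exact ⟨false, h.symm⟩
    · exact ⟨true, h.symm⟩
  exact ⟨fun s => (this s).choose, fun s => (this s).choose_spec⟩

theorem discValue_eq_iSup {α : ℝ} (hα : α ≤ 1) (s : S) :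
    M.discValue α s = ⨆ n, M.valueIter (ENNReal.ofReal α) n s := by
  refine le_antisymm ?_ (iSup_le fun n => le_iInf fun π => M.le_discCost (fun _ => rfl)
    (fun n s a => M.valueIter_succ_le _ n s a) π s n)
  obtain ⟨d, hd⟩ := exists_greedy
    (M.lookahead (ENNReal.ofReal α) (fun s => ⨆ n, M.valueIter (ENNReal.ofReal α) n s))
  refine (iInf_le _ (stationary d)).trans (M.discCost_stationary_le hα
    (w := fun s => ⨆ n, M.valueIter (ENNReal.ofReal α) n s) (fun s => ?_) s)
  rw [hd, ← iSup_valueIter_eq]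

/-- The discounted cost optimality equation. -/
theorem discValue_eq_min {α : ℝ} (hα : α ≤ 1) (s : S) :
    M.discValue α s = min (M.lookahead (ENNReal.ofReal α) (M.discValue α) s false)
      (M.lookahead (ENNReal.ofReal α) (M.discValue α) s true) := by
  have : M.discValue α = fun s => ⨆ n, M.valueIter (ENNReal.ofReal α) n s :=
    funext (M.discValue_eq_iSup hα)
  rw [this]
  exact M.iSup_valueIter_eq _ s

/-- The discounted value is the least nonnegative supersolution of the optimality equation. -/
theorem discValue_le_of_lookahead_le {α : ℝ} (hα : α ≤ 1) {w : S → ℝ≥0∞} {d : S → Bool}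
    (hd : ∀ s, M.lookahead (ENNReal.ofReal α) w s (d s) ≤ w s) (s : S) :
    M.discValue α s ≤ w s :=
  (iInf_le _ (stationary d)).trans (M.discCost_stationary_le hα hd s)

-- Following `d` until `z` and acting optimally afterwards costs at most the right side. Bounding
-- the value iterates avoids gluing two policies together; discounting before the passage only
-- lowers the cost.
open Classical in
theorem discValue_le_firstPassageCost_add {α : ℝ} (hα : α ≤ 1) (d : S → Bool) (z s : S) :
    M.discValue α s ≤ M.firstPassageCost (stationary d) z s + M.discValue α z := by
  have hα' : ENNReal.ofReal α ≤ 1 := ENNReal.ofReal_le_one.2 hα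
  have hz : ∀ n, M.valueIter (ENNReal.ofReal α) n z ≤ M.discValue α z := fun n => by
    rw [discValue_eq_iSup M hα]
    exact le_iSup (fun n => M.valueIter (ENNReal.ofReal α) n z) n
  conv_lhs => rw [discValue_eq_iSup M hα]
  refine iSup_le fun n => ?_
  induction n generalizing s with
  | zero => exact zero_le
  | succ n ih =>
    refine (M.valueIter_succ_le _ n s (d s)).trans ?_
    rw [firstPassageCost_stationary_eq, add_assoc,
      ← PMF.expect_const (M.trans s (d s)) (M.discValue α z), ← PMF.expect_add]
    refine add_le_add le_rfl ((mul_le_of_le_one_left' hα').trans (PMF.expect_mono _ fun s' => ?_))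
    split_ifs with h
    · rw [h, zero_add]; exact hz n
    · exact ih s'

/-- Monotonicity of the discounted value for a process whose costs and transitions are monotone. -/
theorem monotone_discValue [Preorder S] {α : ℝ} (hα : α ≤ 1)
    (hM : ∀ w : S → ℝ≥0∞, Monotone w → ∀ a,
      Monotone fun s => M.lookahead (ENNReal.ofReal α) w s a) :
    Monotone (M.discValue α) := by
  have : ∀ n, Monotone (M.valueIter (ENNReal.ofReal α) n) := fun n => by
    induction n with
    | zero => exact monotone_const
    | succ n ih => exact (hM _ ih false).min (hM _ ih true)
  intro s s' h
  rw [discValue_eq_iSup M hα, discValue_eq_iSup M hα]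
  exact iSup_mono fun n => this n h

/-- A supersolution of the average cost optimality inequality bounds the average cost of the
policy that selects its minimizing actions. -/
theorem avgCost_stationary_le {γ : ℝ≥0∞} {w : S → ℝ≥0∞} {d : S → Bool}
    (hd : ∀ s, M.lookahead 1 w s (d s) ≤ γ + w s) (s : S) (hw : w s ≠ ⊤) :
    M.avgCost (stationary d) s ≤ γ := by
  have hlim : Tendsto (fun T : ℕ => γ + w s / (T : ℝ≥0∞)) atTop (𝓝 (γ + 0)) := by
    refine tendsto_const_nhds.add ?_
    simpa using ENNReal.Tendsto.const_div ENNReal.tendsto_nat_nhds_top (Or.inr hw)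
  rw [add_zero] at hlim
  rw [← hlim.limsup_eq]
  refine limsup_le_limsup ?_
  filter_upwards [eventually_ge_atTop 1] with T hT
  have h := M.sum_stageCost_stationary_le le_rfl hd s T
  simp only [one_pow, one_mul] at h
  refine (ENNReal.div_le_div_right h _).trans ?_
  rw [← ENNReal.div_add_div_same]
  gcongr
  refine ENNReal.div_le_of_le_mul ?_
  rw [mul_comm]

end MDP

/-! ### The memory sampling process: monotonicity and finiteness -/

section Memory

variable (p c : ℝ≥0) (hp : p ≤ 1)

theorem expect_memoryMDP (s : AgeState) (a : Bool) (F : AgeState → ℝ≥0∞) :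
    ((memoryMDP p c hp).trans s a).expect F =
      p * F (0, if a then s.1.succPNat else s.2 + 1) +
        (1 - p : ℝ≥0) * F (s.1 + 1, if a then s.1.succPNat else s.2 + 1) := by
  rw [memoryMDP, PMF.expect_map, PMF.expect, tsum_bool, add_comm]
  simp [updateCoin]

theorem add_one_sub_coe {p : ℝ≥0} (hp : p ≤ 1) : (p : ℝ≥0∞) + (1 - p : ℝ≥0) = 1 := by
  rw [← ENNReal.coe_add, add_tsub_cancel_of_le hp, ENNReal.coe_one]

theorem monotone_lookahead_memoryMDP (α : ℝ≥0∞) (w : AgeState → ℝ≥0∞) (hw : Monotone w)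
    (a : Bool) : Monotone fun s => (memoryMDP p c hp).lookahead α w s a := by
  intro s s' h
  have hy : (if a then s.1.succPNat else s.2 + 1) ≤ if a then s'.1.succPNat else s'.2 + 1 := by
    split_ifs
    · exact Nat.succPNat_le_succPNat.2 h.1
    · exact add_le_add_left h.2 1
  have hcost : (memoryMDP p c hp).cost s a ≤ (memoryMDP p c hp).cost s' a := by
    have : ((s.2 : ℕ) : ℝ≥0) ≤ (s'.2 : ℕ) := by exact_mod_cast h.2
    simp only [memoryMDP]
    gcongr
  simp only [MDP.lookahead, expect_memoryMDP]
  gcongr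
  · exact hw ⟨le_rfl, hy⟩
  · exact hw ⟨add_le_add_left h.1 1, hy⟩

theorem refState_le (s : AgeState) : refState ≤ s := ⟨Nat.zero_le s.1, one_le⟩

theorem discValue_refState_le {α : ℝ} (hα : α ≤ 1) (s : AgeState) :
    (memoryMDP p c hp).discValue α refState ≤ (memoryMDP p c hp).discValue α s :=
  (memoryMDP p c hp).monotone_discValue hα
    (monotone_lookahead_memoryMDP p c hp (ENNReal.ofReal α)) (refState_le s)

theorem discValue_memoryMDP_lt_top {α : ℝ} (h0 : 0 < α) (h1 : α < 1) (s : AgeState) :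
    (memoryMDP p c hp).discValue α s < ⊤ := by
  set a := ENNReal.ofReal α with ha
  set r := ENNReal.ofReal (1 - α)⁻¹ with hr
  have har : r = 1 + a * r := by
    have : 0 < 1 - α := sub_pos.2 h1
    rw [hr, ha, ← ENNReal.ofReal_mul h0.le, ← ENNReal.ofReal_one,
      ← ENNReal.ofReal_add zero_le_one (by positivity)]
    congr 1
    field_simp
    ring
  -- The bound is the exact cost of never reading: `∑ α^t (y + t) = r y + α r²` with `r = 1/(1 -
  -- α)`.
  refine ((memoryMDP p c hp).discValue_le_of_lookahead_le h1.le
    (w := fun s => r * (s.2 : ℕ) + a * r * r) (d := fun _ => false) (fun s => ?_) s).trans_lt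
    (by finiteness)
  rw [← ha, MDP.lookahead, expect_memoryMDP, ← add_mul, add_one_sub_coe hp, one_mul]
  simp only [memoryMDP, Bool.false_eq_true, if_false, mul_zero, add_zero, PNat.add_coe,
    PNat.one_coe, Nat.cast_add, Nat.cast_one, ENNReal.coe_natCast]
  refine le_of_eq ?_
  calc _ = (1 + a * r) * (s.2 : ℕ) + a * r * (1 + a * r) := by ring
    _ = _ := by rw [← har]

theorem alwaysReadPassageCost_lt_top (hp0 : 0 < p) (s : AgeState) :
    alwaysReadPassageCost p c hp s < ⊤ := by
  obtain ⟨q, hq⟩ : ∃ q, q = 1 - p := ⟨_, rfl⟩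
  have hpq : p + q = 1 := by rw [hq, add_tsub_cancel_of_le hp]
  -- The passage equation is solved by `y + φ x` with `φ` affine for `x ≥ 1`; matching slopes gives
  -- `a`, matching constants gives `b`, solvable because `p - p q = p²`. The value `φ 0` is separate
  -- because an update after reading at `x = 0` lands in (0,1).
  obtain ⟨a, ha⟩ : ∃ a, a * p = 1 := ⟨p⁻¹, inv_mul_cancel₀ hp0.ne'⟩
  obtain ⟨b, hb⟩ : ∃ b, b * p = c + 1 + p * (c + q * (1 + a)) + q * a + p * q * b := by
    refine ⟨(c + 1 + p * (c + q * (1 + a)) + q * a) / p ^ 2, ?_⟩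
    generalize c + 1 + p * (c + q * (1 + a)) + q * a = k
    field_simp
    rw [hpq, mul_one]
  let φ : ℕ → ℝ≥0 := fun x => if x = 0 then c + q * (1 + a + b) else a * x + b
  refine ((memoryMDP p c hp).firstPassageCost_stationary_le (fun _ => true) refState
    (w := fun s => (((s.2 : ℕ) + φ s.1 : ℝ≥0) : ℝ≥0∞)) (fun s => ?_) s).trans_lt
    ENNReal.coe_lt_top
  obtain ⟨x, y⟩ := s
  have hne : ((x + 1, x.succPNat) : AgeState) ≠ refState := by simp [refState]
  rw [expect_memoryMDP, ← hq]
  simp only [if_true, hne, if_false]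
  rcases Nat.eq_zero_or_pos x with rfl | hx
  · have h0 : ((0, Nat.succPNat 0) : AgeState) = refState := rfl
    simp only [h0, if_true, mul_zero, zero_add]
    norm_cast
    simp only [memoryMDP, φ]
    simp
    refine le_of_eq ?_
    ring
  · have h0 : ((0, x.succPNat) : AgeState) ≠ refState := by
      intro h
      have := congrArg (fun s : AgeState => (s.2 : ℕ)) h
      simp [refState] at this
      lia
    simp only [h0, if_false]
    norm_cast
    simp only [memoryMDP, φ, hx.ne', if_false, if_true, Nat.succPNat_coe, Nat.succ_eq_add_one,
      Nat.add_eq_zero_iff, one_ne_zero, and_false, mul_one, Nat.cast_add, Nat.cast_one]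
    refine le_of_eq ?_
    apply NNReal.coe_injective
    have hpq' := congrArg NNReal.toReal hpq
    have ha' := congrArg NNReal.toReal ha
    have hb' := congrArg NNReal.toReal hb
    push_cast at hpq' ha' hb' ⊢
    obtain h : (q : ℝ) = 1 - p := by linarith
    rw [h] at hb' ⊢
    linear_combination -hb' - x * ha'

end Memory

/-! ### Relative values and the vanishing discount limit -/

section Memory

variable (p c : ℝ≥0) (hp : p ≤ 1)

/-- The real-valued one-step lookahead of the memory sampling process. -/
noncomputable def ageLookahead (α : ℝ) (f : AgeState → ℝ) (s : AgeState) (a : Bool) : ℝ :=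
  (s.2 : ℕ) + c * (if a then 1 else 0) +
    α * (p * f (0, if a then s.1.succPNat else s.2 + 1) +
      (1 - p) * f (s.1 + 1, if a then s.1.succPNat else s.2 + 1))

theorem lookahead_memoryMDP_ne_top {α : ℝ≥0∞} (hα : α ≠ ⊤) {w : AgeState → ℝ≥0∞}
    (hw : ∀ s, w s ≠ ⊤) (s : AgeState) (a : Bool) :
    (memoryMDP p c hp).lookahead α w s a ≠ ⊤ := by
  rw [MDP.lookahead, expect_memoryMDP]
  have h0 := hw (0, if a then s.1.succPNat else s.2 + 1)
  have h1 := hw (s.1 + 1, if a then s.1.succPNat else s.2 + 1)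
  finiteness

theorem toReal_lookahead_memoryMDP {α : ℝ} (hα : 0 ≤ α) {w : AgeState → ℝ≥0∞}
    (hw : ∀ s, w s ≠ ⊤) (s : AgeState) (a : Bool) :
    ((memoryMDP p c hp).lookahead (ENNReal.ofReal α) w s a).toReal =
      ageLookahead p c α (fun s => (w s).toReal) s a := by
  rw [MDP.lookahead, expect_memoryMDP]
  have h0 := hw (0, if a then s.1.succPNat else s.2 + 1)
  have h1 := hw (s.1 + 1, if a then s.1.succPNat else s.2 + 1)
  rw [ENNReal.toReal_add (by finiteness) (by finiteness), ENNReal.toReal_mul,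
    ENNReal.toReal_add (by finiteness) (by finiteness), ENNReal.toReal_mul, ENNReal.toReal_mul,
    ENNReal.toReal_ofReal hα]
  simp only [ENNReal.coe_toReal, NNReal.coe_sub hp, NNReal.coe_one, ageLookahead, memoryMDP]
  split_ifs <;> simp

/-- The discounted value relative to the reference state. -/
noncomputable def relValue (α : ℝ) (s : AgeState) : ℝ :=
  ((memoryMDP p c hp).discValue α s).toReal - ((memoryMDP p c hp).discValue α refState).toReal

theorem relValue_refState (α : ℝ) : relValue p c hp α refState = 0 := sub_self _

theorem relValue_nonneg {α : ℝ} (h0 : 0 < α) (h1 : α < 1) (s : AgeState) :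
    0 ≤ relValue p c hp α s :=
  sub_nonneg.2 (ENNReal.toReal_mono (discValue_memoryMDP_lt_top p c hp h0 h1 s).ne
    (discValue_refState_le p c hp h1.le s))

theorem relValue_le (hp0 : 0 < p) {α : ℝ} (h0 : 0 < α) (h1 : α < 1) (s : AgeState) :
    relValue p c hp α s ≤ (alwaysReadPassageCost p c hp s).toReal := by
  have hM := (alwaysReadPassageCost_lt_top p c hp hp0 s).ne
  have hz := (discValue_memoryMDP_lt_top p c hp h0 h1 refState).ne
  rw [relValue, sub_le_iff_le_add, ← ENNReal.toReal_add hM hz]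
  exact ENNReal.toReal_mono (by finiteness)
    ((memoryMDP p c hp).discValue_le_firstPassageCost_add h1.le (fun _ => true) refState s)

/-- Transition probabilities sum to 1, so subtracting `α V_α(0,1)` from the optimality equation only
recentres both lookaheads. -/
theorem relValue_eq_min {α : ℝ} (h0 : 0 < α) (h1 : α < 1) (s : AgeState) :
    (1 - α) * ((memoryMDP p c hp).discValue α refState).toReal + relValue p c hp α s =
      min (ageLookahead p c α (relValue p c hp α) s false)
        (ageLookahead p c α (relValue p c hp α) s true) := by
  have hfin := fun s => (discValue_memoryMDP_lt_top p c hp h0 h1 s).ne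
  have h := congrArg ENNReal.toReal ((memoryMDP p c hp).discValue_eq_min h1.le s)
  rw [ENNReal.toReal_min
    (lookahead_memoryMDP_ne_top p c hp ENNReal.ofReal_ne_top hfin s false)
    (lookahead_memoryMDP_ne_top p c hp ENNReal.ofReal_ne_top hfin s true),
    toReal_lookahead_memoryMDP p c hp h0.le hfin,
    toReal_lookahead_memoryMDP p c hp h0.le hfin] at h
  have hl : ∀ a, ageLookahead p c α (relValue p c hp α) s a =
      ageLookahead p c α (fun s => ((memoryMDP p c hp).discValue α s).toReal) s a -
        α * ((memoryMDP p c hp).discValue α refState).toReal := fun a => by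
    simp only [ageLookahead, relValue]
    ring
  rw [hl, hl, min_sub_sub_right, ← h, relValue]
  ring

theorem sennottConditions_memoryMDP (hp0 : 0 < p) :
    (memoryMDP p c hp).SennottConditions refState 0
      (fun s => (alwaysReadPassageCost p c hp s).toReal) where
  bound_nonneg _ := ENNReal.toReal_nonneg
  value_finite _ h0 h1 s := discValue_memoryMDP_lt_top p c hp h0 h1 s
  lower _ h0 h1 s := neg_zero.trans_le (relValue_nonneg p c hp h0 h1 s)
  upper _ h0 h1 s := relValue_le p c hp hp0 h0 h1 s
  next_finite s a := by
    change ((memoryMDP p c hp).trans s a).expect _ < ⊤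
    rw [expect_memoryMDP]
    finiteness

/-- This replaces a diagonal extraction of subsequences over the states. -/
theorem Ultrafilter.exists_tendsto_of_forall_mem_Icc {ι : Type} (U : Ultrafilter ι) {k : ι → ℝ}
    {a b : ℝ} (h : ∀ᶠ i in (U : Filter ι), k i ∈ Set.Icc a b) :
    ∃ l ∈ Set.Icc a b, Tendsto k U (𝓝 l) :=
  isCompact_Icc.ultrafilter_le_nhds' (U.map k) h

theorem eventually_mem_Ioo_zero_one : ∀ᶠ α : ℝ in 𝓝[<] 1, α ∈ Set.Ioo (0 : ℝ) 1 :=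
  Ioo_mem_nhdsLT zero_lt_one

/-- Vanishing discount along an ultrafilter: limits of the relative values solve the average cost
optimality equation. -/
theorem exists_vanishing_discount_limit (hp0 : 0 < p) (U : Ultrafilter ℝ)
    (hU : (U : Filter ℝ) ≤ 𝓝[<] 1) :
    ∃ (g : ℝ) (f : AgeState → ℝ), 0 ≤ g ∧
      (∀ s, Tendsto (fun α : ℝ => (1 - α) * ((memoryMDP p c hp).discValue α s).toReal) U (𝓝 g)) ∧
      (∀ s, 0 ≤ f s ∧ f s ≤ (alwaysReadPassageCost p c hp s).toReal) ∧
      f refState = 0 ∧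
      ∀ s, g + f s = min (ageLookahead p c 1 f s false) (ageLookahead p c 1 f s true) := by
  have hIoo : ∀ᶠ α in (U : Filter ℝ), α ∈ Set.Ioo (0 : ℝ) 1 := hU eventually_mem_Ioo_zero_one
  have hα : Tendsto (fun α : ℝ => α) U (𝓝 1) := hU.trans nhdsWithin_le_nhds
  have hf : ∀ s, ∃ l ∈ Set.Icc 0 (alwaysReadPassageCost p c hp s).toReal,
      Tendsto (fun α => relValue p c hp α s) U (𝓝 l) := fun s =>
    U.exists_tendsto_of_forall_mem_Icc <| hIoo.mono fun α h =>
      ⟨relValue_nonneg p c hp h.1 h.2 s, relValue_le p c hp hp0 h.1 h.2 s⟩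
  choose f hfM hf using hf
  have hlook : ∀ s a, Tendsto (fun α => ageLookahead p c α (relValue p c hp α) s a) U
      (𝓝 (ageLookahead p c 1 f s a)) := fun s a =>
    tendsto_const_nhds.add (hα.mul (((hf _).const_mul _).add ((hf _).const_mul _)))
  have hmin := fun s => (hlook s false).min (hlook s true)
  have href : f refState = 0 := by
    refine tendsto_nhds_unique (hf refState) ?_
    simp only [relValue_refState]
    exact tendsto_const_nhds
  set g := min (ageLookahead p c 1 f refState false) (ageLookahead p c 1 f refState true) with hg
  have hgref : Tendsto (fun α : ℝ => (1 - α) *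
      ((memoryMDP p c hp).discValue α refState).toReal) U (𝓝 g) := by
    refine (hmin refState).congr' (hIoo.mono fun α h => ?_)
    rw [← relValue_eq_min p c hp h.1 h.2, relValue_refState, add_zero]
  refine ⟨g, f, ?_, fun s => ?_, fun s => hfM s, href, fun s => ?_⟩
  · exact ge_of_tendsto hgref (hIoo.mono fun α h =>
      mul_nonneg (sub_nonneg.2 h.2.le) ENNReal.toReal_nonneg)
  -- The values at `s` and at (0,1) differ by a relative value with a finite limit, which the factor
  -- `1 - α` kills.
  · have h := hgref.add ((hα.const_sub 1).mul (hf s))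
    rw [sub_self, zero_mul, add_zero] at h
    refine h.congr fun α => ?_
    rw [relValue]
    ring
  · refine tendsto_nhds_unique (hgref.add (hf s)) ((hmin s).congr' (hIoo.mono fun α h => ?_))
    exact (relValue_eq_min p c hp h.1 h.2 s).symm

end Memory

/-! ### Average cost optimality -/

theorem MDP.le_avgCost_of_tendsto {S A : Type} (M : MDP S A) {F : Filter ℝ} [F.NeBot]
    (hF : F ≤ 𝓝[<] 1) {g : ℝ} {s : S}
    (hfin : ∀ α : ℝ, 0 < α → α < 1 → M.discValue α s ≠ ⊤)
    (hg : Tendsto (fun α : ℝ => (1 - α) * (M.discValue α s).toReal) F (𝓝 g))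
    (π : MDP.Policy S A) : ENNReal.ofReal g ≤ M.avgCost π s := by
  refine le_of_forall_gt fun b hb => ?_
  obtain ⟨L, hL, hLb⟩ := ENNReal.lt_iff_exists_nnreal_btwn.1 hb
  refine lt_of_le_of_lt ?_ hLb
  obtain ⟨K, hK⟩ := M.exists_discCost_le_of_avgCost_lt π s hL
  have hα : Tendsto (fun α : ℝ => α) F (𝓝 1) := hF.trans nhdsWithin_le_nhds
  have hlim : Tendsto (fun α : ℝ => (L : ℝ≥0∞) + ENNReal.ofReal (1 - α) * K) F
      (𝓝 (L + ENNReal.ofReal (1 - 1) * K)) :=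
    tendsto_const_nhds.add (ENNReal.Tendsto.mul_const
      (ENNReal.tendsto_ofReal (hα.const_sub 1)) (Or.inr ENNReal.coe_ne_top))
  rw [sub_self, ENNReal.ofReal_zero, zero_mul, add_zero] at hlim
  refine le_of_tendsto_of_tendsto (ENNReal.tendsto_ofReal hg) hlim ?_
  filter_upwards [hF eventually_mem_Ioo_zero_one] with α h
  rw [ENNReal.ofReal_mul (sub_nonneg.2 h.2.le), ENNReal.ofReal_toReal (hfin α h.1 h.2)]
  refine le_trans ?_ (hK α h.1 h.2)
  gcongr
  exact iInf_le _ π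

/-- A policy selecting minimizing actions in the average cost optimality equation has average cost
at most the constant of that equation. -/
theorem exists_avgCost_stationary_le (p c : ℝ≥0) (hp : p ≤ 1) {g : ℝ} {f : AgeState → ℝ}
    (hg : 0 ≤ g) (hf : ∀ s, 0 ≤ f s)
    (h : ∀ s, g + f s = min (ageLookahead p c 1 f s false) (ageLookahead p c 1 f s true)) :
    ∃ d, ∀ s, (memoryMDP p c hp).avgCost (MDP.stationary d) s ≤ ENNReal.ofReal g := by
  have hw : ∀ s, ENNReal.ofReal (f s) ≠ ⊤ := fun s => ENNReal.ofReal_ne_top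
  have hl : ∀ s a, (memoryMDP p c hp).lookahead 1 (fun s => ENNReal.ofReal (f s)) s a =
      ENNReal.ofReal (ageLookahead p c 1 f s a) := fun s a => by
    have h1 := toReal_lookahead_memoryMDP p c hp zero_le_one hw s a
    simp only [ENNReal.toReal_ofReal (hf _), ENNReal.ofReal_one] at h1
    rw [← h1, ENNReal.ofReal_toReal (lookahead_memoryMDP_ne_top p c hp ENNReal.one_ne_top hw s a)]
  obtain ⟨d, hd⟩ := MDP.exists_greedy
    ((memoryMDP p c hp).lookahead 1 (fun s => ENNReal.ofReal (f s)))
  refine ⟨d, fun s => (memoryMDP p c hp).avgCost_stationary_le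
    (w := fun s => ENNReal.ofReal (f s)) (fun s => ?_) s (hw s)⟩
  rw [hd, hl, hl, ← ENNReal.ofReal_add hg (hf s), h s,
    ENNReal.ofReal_mono.map_min]

theorem mainTheorem3 (p c : ℝ≥0) (hp0 : 0 < p) (hp1 : p ≤ 1) :
    (∀ s, alwaysReadPassageCost p c hp1 s < ⊤) ∧
    (memoryMDP p c hp1).SennottConditions refState 0
      (fun s => (alwaysReadPassageCost p c hp1 s).toReal) ∧
    ∃ (d : AgeState → Bool) (g : ℝ) (f : AgeState → ℝ),
      (memoryMDP p c hp1).IsAvgOptimal (MDP.stationary d) ∧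
      (∀ s, (memoryMDP p c hp1).avgCost (MDP.stationary d) s = ENNReal.ofReal g) ∧
      (∀ s, Tendsto (fun α : ℝ => (1 - α) * ((memoryMDP p c hp1).discValue α s).toReal)
        (𝓝[<] 1) (𝓝 g)) ∧
      (∀ s, 0 ≤ f s ∧ f s ≤ (alwaysReadPassageCost p c hp1 s).toReal) ∧
      f refState = 0 ∧
      ∀ (x : ℕ) (y : ℕ+),
        g + f (x, y) =
          min ((y : ℝ) + (p * f (0, y + 1) + (1 - p) * f (x + 1, y + 1)))
            ((y : ℝ) + c + (p * f (0, x.succPNat) + (1 - p) * f (x + 1, x.succPNat))) := by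
  refine ⟨alwaysReadPassageCost_lt_top p c hp1 hp0, sennottConditions_memoryMDP p c hp1 hp0, ?_⟩
  have hfin := fun s (α : ℝ) h0 h1 => (discValue_memoryMDP_lt_top p c hp1 (α := α) h0 h1 s).ne
  obtain ⟨g, f, hg, hlim, hfM, href, hacoe⟩ := exists_vanishing_discount_limit p c hp1 hp0
    (Ultrafilter.of (𝓝[<] 1)) (Ultrafilter.of_le _)
  obtain ⟨d, hd⟩ := exists_avgCost_stationary_le p c hp1 hg (fun s => (hfM s).1) hacoe
  have hlow : ∀ s π, ENNReal.ofReal g ≤ (memoryMDP p c hp1).avgCost π s := fun s π =>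
    (memoryMDP p c hp1).le_avgCost_of_tendsto (Ultrafilter.of_le _) (hfin s) (hlim s) π
  have havg : ∀ s, (memoryMDP p c hp1).avgCost (MDP.stationary d) s = ENNReal.ofReal g :=
    fun s => le_antisymm (hd s) (hlow s _)
  refine ⟨d, g, f, fun s => ?_, havg, fun s => ?_, hfM, href, fun x y => ?_⟩
  · exact le_antisymm (le_iInf fun π => (hd s).trans (hlow s π)) (iInf_le _ _)
  -- Both `g` and the limit `g'` along `U` bound every policy's average cost from below and are
  -- attained by some policy, so they agree.
  · rw [tendsto_iff_ultrafilter]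
    intro U hU
    obtain ⟨g', f', hg', hlim', hfM', -, hacoe'⟩ :=
      exists_vanishing_discount_limit p c hp1 hp0 U hU
    obtain ⟨d', hd'⟩ := exists_avgCost_stationary_le p c hp1 hg' (fun s => (hfM' s).1) hacoe'
    have h1 : g ≤ g' := (ENNReal.ofReal_le_ofReal_iff hg').1 ((hlow s _).trans (hd' s))
    have h2 : g' ≤ g := (ENNReal.ofReal_le_ofReal_iff hg).1
      (((memoryMDP p c hp1).le_avgCost_of_tendsto hU (hfin s) (hlim' s) _).trans (hd s))
    rw [le_antisymm h1 h2]
    exact hlim' s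
  · simpa [ageLookahead] using hacoe (x, y)
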